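/- Let $D$ be a division ring with center $F=Z(D)$. Call $D$ weakly locally finite if for every finite subset $S\subseteq D$ the division subring $L$ of $D$ generated by $S$ is finite-dimensional as a vector space over its own center $Z(L)$. Call $D$ locally PI if every finitely generated $F$-subalgebra $B$ of $D$ is a PI algebra over $F$, that is, there are a number $m$ of variables and a nonzero polynomial $f\in F\langle x_1,\dots,x_m\rangle$ in noncommuting variables (both possibly depending on $B$) such that $f(b_1,\dots,b_m)=0$ for all $b_1,\dots,b_m\in B$. Then $D$ is weakly locally finite if and only if $D$ is locally PI. -/

import Mathlib

/-- An algebra `A` over a field `k` is a PI algebra if some nonzero polynomial with coefficients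
in `k` in noncommuting variables `x₀, x₁, x₂, …` vanishes under every substitution of elements
of `A` for the variables. -/
def IsPIAlgebra (k A : Type*) [Field k] [Ring A] [Algebra k A] : Prop :=
  ∃ f : FreeAlgebra k ℕ, f ≠ 0 ∧ ∀ a : ℕ → A, FreeAlgebra.lift k a f = 0

/-- An algebra over a field `k` is locally PI if each of its finitely generated subalgebras is a
PI algebra over `k`. -/
def IsLocallyPIAlgebra (k A : Type*) [Field k] [Ring A] [Algebra k A] : Prop :=
  ∀ B : Subalgebra k A, B.FG → IsPIAlgebra k B

/-- A division ring is centrally finite if it is a finite-dimensional vector space over its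
center. -/
def IsCentrallyFinite (D : Type*) [DivisionRing D] : Prop :=
  FiniteDimensional (Subring.center D) D

/-- A division ring `D` is weakly locally finite if, for every finite subset `S`, the division
subring generated by `S` in `D` is centrally finite. (Mathlib's `Subfield` of a division ring is a
division subring, not assumed commutative.) -/
def IsWeaklyLocallyFinite (D : Type*) [DivisionRing D] : Prop :=
  ∀ S : Finset D, IsCentrallyFinite (Subfield.closure (S : Set D))

/-! If `D` is weakly locally finite, let `L` be generated by a finite set and let `R` be the
centralizer of `Z(L)` in `D`. Then `R` contains both `L` and `F`, and `Z(L)` is central in `R`, so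
`L` spans a finite-dimensional algebra over `Z(R)`. It contains the `F`-algebra generated by the
set, which therefore satisfies a standard identity (`isPIAlgebra_of_mem_finiteDimensional`).

The converse rests on a form of Kaplansky's theorem (`isCentrallyFinite_of_multilinear_identity`)
that requires the identity only on a generating subring, so no identity has to be carried over to
inverses. If the division ring were infinite over its center, an operator `x ↦ ∑ q x r` of finite
rank on that subring would vanish. This separates the monomials of a multilinear identity by the
order of any two variables, until a single monomial is left, which is absurd at `1`. -/

/-! ### Generalized linear operators of finite rank. -/

section FiniteRank

variable {D : Type*} [DivisionRing D]

/-- A division ring generated by a subring that lies in a finite-dimensional subspace over the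
center is centrally finite. -/
theorem isCentrallyFinite_of_subring_le (B : Subring D)
    (hB : Subfield.closure (B : Set D) = ⊤) (V : Submodule (Subring.center D) D)
    [FiniteDimensional (Subring.center D) V] (hV : ∀ x ∈ B, x ∈ V) : IsCentrallyFinite D := by
  let A := Algebra.adjoin (Subring.center D) (B : Set D)
  have hA : Subalgebra.toSubmodule A ≤ V := by
    rw [Algebra.adjoin_eq_span, show Submonoid.closure (B : Set D) = B.toSubmonoid from
      Submonoid.closure_eq B.toSubmonoid]
    exact Submodule.span_le.2 hV
  have hfd : FiniteDimensional (Subring.center D) A :=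
    Submodule.finiteDimensional_of_le (S₁ := Subalgebra.toSubmodule A) hA
  have hinv : ∀ x ∈ A, x⁻¹ ∈ A := by
    intro x hx
    rcases eq_or_ne x 0 with rfl | hx0
    · simp
    let m : A →ₗ[Subring.center D] A := LinearMap.mulLeft _ ⟨x, hx⟩
    have hm : Function.Injective m := by
      intro y z hyz
      have := congrArg Subtype.val hyz
      exact Subtype.ext (mul_left_cancel₀ hx0 this)
    obtain ⟨y, hy⟩ := LinearMap.injective_iff_surjective.1 hm 1
    have : x * y = 1 := congrArg Subtype.val hy
    rw [inv_eq_of_mul_eq_one_right this]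
    exact y.2
  let K : Subfield D := { A.toSubring with inv_mem' := hinv }
  have hK : K = ⊤ := by
    rw [eq_top_iff, ← hB, Subfield.closure_le]
    exact Algebra.subset_adjoin
  have hAtop : A = ⊤ := by
    rw [eq_top_iff]
    intro x _
    have : x ∈ K := hK ▸ Subfield.mem_top x
    exact this
  rw [hAtop] at hfd
  exact Module.Finite.equiv (Subalgebra.topEquiv (R := Subring.center D) (A := D)).toLinearEquiv

/-- An element commuting with a generating subring of a division ring is central. -/
theorem mem_center_of_commute_subring (B : Subring D)
    (hB : Subfield.closure (B : Set D) = ⊤) {z : D} (hz : ∀ x ∈ B, x * z = z * x) :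
    z ∈ Subring.center D := by
  let K : Subfield D :=
    { Subring.centralizer ({z} : Set D) with
      inv_mem' := fun x hx => by
        have hx' : ∀ m ∈ ({z} : Set D), m * x = x * m := Subring.mem_centralizer_iff.1 hx
        have : Commute z x := hx' z rfl
        exact Subring.mem_centralizer_iff.2 fun m hm => by
          rw [Set.mem_singleton_iff.1 hm]
          exact this.inv_right₀.eq }
  have hK : K = ⊤ := by
    rw [eq_top_iff, ← hB, Subfield.closure_le]
    intro x hx
    exact Subring.mem_centralizer_iff.2 fun m hm => by
      rw [Set.mem_singleton_iff.1 hm]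
      exact (hz x hx).symm
  refine Subring.mem_center_iff.2 fun x => ?_
  have : x ∈ K := hK ▸ Subfield.mem_top x
  exact (Subring.mem_centralizer_iff.1 this z rfl).symm

/-- If `D` is generated by the subring `B` and is not centrally finite, an operator
`x ↦ ∑ eₖ x bₖ` with linearly independent `eₖ` has finite rank on `B` only if all `bₖ` vanish. -/
theorem eq_zero_of_sum_mul_mul_mem (B : Subring D) (hB : Subfield.closure (B : Set D) = ⊤)
    (hD : ¬ IsCentrallyFinite D) {κ : Type*} {e : κ → D}
    (he : LinearIndependent (Subring.center D) e) (s : Finset κ) :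
    ∀ (b : κ → D) (V : Submodule (Subring.center D) D), FiniteDimensional (Subring.center D) V →
      (∀ x ∈ B, ∑ k ∈ s, e k * x * b k ∈ V) → ∀ k ∈ s, b k = 0 := by
  classical
  induction s using Finset.induction_on with
  | empty => simp
  | insert i t hi ih =>
    intro b V hVfd hV
    by_cases hb : b i = 0
    · have := ih b V hVfd fun x hx => by
        have := hV x hx
        rwa [Finset.sum_insert hi, hb, mul_zero, zero_add] at this
      intro k hk
      rcases Finset.mem_insert.1 hk with rfl | hk
      exacts [hb, this k hk]
    exfalso
    -- The operator is normalized to have right coefficient 1 at `i`. In `φ (x * y) - φ x * y` the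
    -- `i`-term then cancels, and induction shows that the other coefficients commute with `B`.
    let φ : D → D := fun x => ∑ k ∈ insert i t, e k * x * (b k * (b i)⁻¹)
    let W := V.map (LinearMap.mulRight (Subring.center D) (b i)⁻¹)
    have hφ : ∀ x ∈ B, φ x ∈ W := fun x hx => by
      refine ⟨_, hV x hx, ?_⟩
      simp only [LinearMap.mulRight_apply, Finset.sum_mul, φ, mul_assoc]
    have hcomm : ∀ y ∈ B, ∀ k ∈ insert i t, y * (b k * (b i)⁻¹) - b k * (b i)⁻¹ * y = 0 := by
      intro y hy k hk
      have hi0 : y * (b i * (b i)⁻¹) - b i * (b i)⁻¹ * y = 0 := by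
        rw [mul_inv_cancel₀ hb, mul_one, one_mul, sub_self]
      rcases Finset.mem_insert.1 hk with rfl | hk
      · exact hi0
      refine ih (fun k => y * (b k * (b i)⁻¹) - b k * (b i)⁻¹ * y)
        (W ⊔ W.map (LinearMap.mulRight (Subring.center D) y)) inferInstance ?_ k hk
      intro x hx
      have : ∑ k ∈ t, e k * x * (y * (b k * (b i)⁻¹) - b k * (b i)⁻¹ * y) =
          φ (x * y) - φ x * y := by
        simp only [φ]
        rw [Finset.sum_mul, ← Finset.sum_sub_distrib, Finset.sum_insert hi,
          show e i * (x * y) * (b i * (b i)⁻¹) - e i * x * (b i * (b i)⁻¹) * y =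
            e i * x * (y * (b i * (b i)⁻¹) - b i * (b i)⁻¹ * y) by
              simp only [mul_sub, mul_assoc], hi0, mul_zero, zero_add]
        exact Finset.sum_congr rfl fun k _ => by simp only [mul_sub, mul_assoc]
      rw [this]
      exact Submodule.sub_mem _ (Submodule.mem_sup_left (hφ _ (B.mul_mem hx hy)))
        (Submodule.mem_sup_right ⟨_, hφ x hx, rfl⟩)
    have hcen : ∀ k ∈ insert i t, b k * (b i)⁻¹ ∈ Subring.center D := fun k hk =>
      mem_center_of_commute_subring B hB fun y hy => sub_eq_zero.1 (hcomm y hy k hk)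
    -- With central coefficients, `φ` is left multiplication by `φ 1`, which is nonzero by
    -- independence of `e`; finite rank then puts `B` in a finite-dimensional space.
    have hφmul : ∀ x, φ x = φ 1 * x := fun x => by
      simp only [φ, Finset.sum_mul]
      refine Finset.sum_congr rfl fun k hk => ?_
      rw [mul_one, mul_assoc, mul_assoc, Subring.mem_center_iff.1 (hcen k hk) x]
    have hφ1 : φ 1 ≠ 0 := by
      intro h0
      let g : κ → Subring.center D := fun k =>
        if hk : k ∈ insert i t then ⟨_, hcen k hk⟩ else 0
      have hg : ∑ k ∈ insert i t, g k • e k = 0 := by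
        rw [← h0]
        refine Finset.sum_congr rfl fun k hk => ?_
        simp only [g, dif_pos hk, Subring.smul_def, smul_eq_mul, mul_one]
        exact (Subring.mem_center_iff.1 (hcen k hk) (e k)).symm
      have := linearIndependent_iff'.1 he _ g hg i (Finset.mem_insert_self i t)
      simp only [g, dif_pos (Finset.mem_insert_self i t)] at this
      have := congrArg Subtype.val this
      exact one_ne_zero ((mul_inv_cancel₀ hb).symm.trans this)
    refine hD (isCentrallyFinite_of_subring_le B hB
      (W.map (LinearMap.mulLeft (Subring.center D) (φ 1)⁻¹)) fun x hx => ⟨_, hφ x hx, ?_⟩)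
    rw [LinearMap.mulLeft_apply, hφmul x, inv_mul_cancel_left₀ hφ1]

/-- Expansion of `∑ aⱼ y zⱼ` with respect to a basis over the center. -/
theorem sum_mul_mul_eq_sum_basis {κ β : Type*} (e : Module.Basis κ (Subring.center D) D)
    (t : Finset β) (a z : β → D) (K : Finset κ) (hK : ∀ j ∈ t, (e.repr (a j)).support ⊆ K)
    (y : D) :
    ∑ j ∈ t, a j * y * z j = ∑ k ∈ K, e k * y * ∑ j ∈ t, e.repr (a j) k • z j := by
  simp only [Finset.mul_sum]
  rw [Finset.sum_comm]
  refine Finset.sum_congr rfl fun j hj => ?_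
  conv_lhs => rw [← e.linearCombination_repr (a j), Finsupp.linearCombination_apply,
    Finsupp.sum_of_support_subset _ (hK j hj) _ (fun k _ => zero_smul _ (e k))]
  simp only [Finset.sum_mul, smul_mul_assoc, mul_smul_comm]

/-- A generalized linear operator on a generating subring of finite rank is zero, unless the
division ring is centrally finite. -/
theorem sum_mul_mul_eq_zero (B : Subring D) (hB : Subfield.closure (B : Set D) = ⊤)
    (hD : ¬ IsCentrallyFinite D) {β : Type*} (t : Finset β) (q r : β → D)
    (V : Submodule (Subring.center D) D) [FiniteDimensional (Subring.center D) V]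
    (h : ∀ x ∈ B, ∑ j ∈ t, q j * x * r j ∈ V) (x : D) : ∑ j ∈ t, q j * x * r j = 0 := by
  classical
  let e := Module.Basis.ofVectorSpace (Subring.center D) D
  have hexp := sum_mul_mul_eq_sum_basis e t q r
    (t.biUnion fun j => (e.repr (q j)).support) fun j hj =>
      Finset.subset_biUnion_of_mem (fun j => (e.repr (q j)).support) hj
  rw [hexp]
  refine Finset.sum_eq_zero fun k hk => ?_
  have := eq_zero_of_sum_mul_mul_mem B hB hD e.linearIndependent _
    (fun k => ∑ j ∈ t, e.repr (q j) k • r j) V inferInstance (fun x hx => hexp x ▸ h x hx) k hk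
  rw [this, mul_zero]

/-- In a generalized bilinear identity on a generating subring of a division ring that is not
centrally finite, the monomials in which `y` precedes `x` cancel among themselves. -/
theorem sum_eq_zero_of_sum_add_sum_eq_zero (B : Subring D)
    (hB : Subfield.closure (B : Set D) = ⊤) (hD : ¬ IsCentrallyFinite D) {α β : Type*}
    (s : Finset α) (t : Finset β) (p q r : α → D) (p' q' r' : β → D)
    (h : ∀ x ∈ B, ∀ y ∈ B, ∑ i ∈ s, p i * x * q i * y * r i +
      ∑ j ∈ t, p' j * y * q' j * x * r' j = 0) (x y : D) :
    ∑ j ∈ t, p' j * y * q' j * x * r' j = 0 := by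
  classical
  let e := Module.Basis.ofVectorSpace (Subring.center D) D
  have hassoc : ∀ x y, ∑ j ∈ t, p' j * y * q' j * x * r' j =
      ∑ j ∈ t, p' j * y * (q' j * x * r' j) := fun x y => by simp only [mul_assoc]
  -- For fixed `x` the identity is linear in `y`, so each coordinate of its left coefficients gives
  -- a relation. The terms with `x` first contribute only combinations of the `r i`, so the
  -- remaining operator in `x` has finite rank.
  let V := Submodule.span (Subring.center D) ((s.image r : Finset D) : Set D)
  have hfr : ∀ k, ∀ x ∈ B,
      ∑ j ∈ t, (e.repr (p' j) k • q' j) * x * r' j ∈ V := by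
    intro k x hx
    let K := insert k ((s.biUnion fun i => (e.repr (p i * x * q i)).support) ∪
      t.biUnion fun j => (e.repr (p' j)).support)
    have h1 := sum_mul_mul_eq_sum_basis e s (fun i => p i * x * q i) r K fun i hi =>
      ((Finset.subset_biUnion_of_mem (fun i => (e.repr (p i * x * q i)).support) hi).trans
        Finset.subset_union_left).trans (Finset.subset_insert _ _)
    have h2 := sum_mul_mul_eq_sum_basis e t p' (fun j => q' j * x * r' j) K fun j hj =>
      ((Finset.subset_biUnion_of_mem (fun j => (e.repr (p' j)).support) hj).trans
        Finset.subset_union_right).trans (Finset.subset_insert _ _)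
    have h3 := eq_zero_of_sum_mul_mul_mem B hB hD e.linearIndependent K _ ⊥ inferInstance
      (fun y hy => by
        have := h x hx y hy
        rw [hassoc, h1, h2, ← Finset.sum_add_distrib] at this
        simp only [← mul_add] at this
        exact (Submodule.mem_bot _).2 this) k (Finset.mem_insert_self _ _)
    simp only [smul_mul_assoc]
    rw [eq_neg_of_add_eq_zero_right h3]
    exact V.neg_mem (V.sum_mem fun i hi => V.smul_mem _
      (Submodule.subset_span (Finset.mem_coe.2 (Finset.mem_image_of_mem r hi))))
  rw [hassoc, sum_mul_mul_eq_sum_basis e t p' _ (t.biUnion fun j => (e.repr (p' j)).support)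
    fun j hj => Finset.subset_biUnion_of_mem (fun j => (e.repr (p' j)).support) hj]
  refine Finset.sum_eq_zero fun k _ => ?_
  have := sum_mul_mul_eq_zero B hB hD t _ _ V (hfr k) x
  simp only [smul_mul_assoc] at this
  rw [this, mul_zero]

end FiniteRank

/-! ### Multilinear identities and the order of variables. -/

section MultilinearIdentity

variable {D : Type*} [DivisionRing D]

theorem exists_prod_map_update_update {ι : Type*} [DecidableEq ι] {i j : ι} {w : List ι}
    (hw : w.Nodup) (hij : [i, j].Sublist w) (a : ι → D) :
    ∃ p q r : D, ∀ x y : D,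
      (w.map (Function.update (Function.update a i x) j y)).prod = p * x * q * y * r := by
  obtain ⟨l₁, l₂, rfl, h₁, h₂⟩ := List.cons_sublist_iff.1 hij
  obtain ⟨s, t, rfl⟩ := List.append_of_mem h₁
  obtain ⟨u, v, rfl⟩ := List.append_of_mem (List.singleton_sublist.1 h₂)
  have hne : i ≠ j := by grind
  have hmap : ∀ l : List ι, i ∉ l → j ∉ l → ∀ x y : D,
      l.map (Function.update (Function.update a i x) j y) = l.map a := by
    intro l hi hj x y
    refine List.map_congr_left fun m hm => ?_
    rw [Function.update_of_ne (by grind), Function.update_of_ne (by grind)]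
  refine ⟨(s.map a).prod, ((t ++ u).map a).prod, (v.map a).prod, fun x y => ?_⟩
  simp only [List.map_append, List.map_cons, List.prod_append, List.prod_cons]
  rw [hmap s (by grind) (by grind), hmap t (by grind) (by grind), hmap u (by grind) (by grind),
    hmap v (by grind) (by grind), Function.update_self, Function.update_of_ne hne,
    Function.update_self]
  simp only [mul_assoc]

theorem pair_sublist_or_pair_sublist {ι : Type*} {i j : ι} {w : List ι} (hij : i ≠ j)
    (hi : i ∈ w) (hj : j ∈ w) : [i, j].Sublist w ∨ [j, i].Sublist w := by
  obtain ⟨s, t, rfl⟩ := List.append_of_mem hi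
  rcases List.mem_append.1 hj with h | h
  · right
    exact (List.singleton_sublist.2 h).append (List.singleton_sublist.2 List.mem_cons_self)
  · left
    rcases List.mem_cons.1 h with h | h
    · exact absurd h.symm hij
    · exact ((List.singleton_sublist.2 h).cons_cons i).trans (List.sublist_append_right _ _)

theorem not_pair_sublist_of_pair_sublist {ι : Type*} {i j : ι} {w : List ι} (hw : w.Nodup)
    (hij : [i, j].Sublist w) : ¬ [j, i].Sublist w := by
  intro hji
  obtain ⟨l₁, l₂, rfl, h₁, h₂⟩ := List.cons_sublist_iff.1 hij
  obtain ⟨l₃, l₄, h, h₃, h₄⟩ := List.cons_sublist_iff.1 hji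
  have h₂ := List.singleton_sublist.1 h₂
  have h₄ := List.singleton_sublist.1 h₄
  have hd := List.disjoint_of_nodup_append hw
  have hd' := List.disjoint_of_nodup_append (h ▸ hw)
  rcases List.append_eq_append_iff.1 h with ⟨u, rfl, rfl⟩ | ⟨u, rfl, rfl⟩ <;> grind [List.Disjoint]

/-- The part of a multilinear identity on a generating subring consisting of the monomials in
which `i` precedes `j` is again an identity, unless the division ring is centrally finite. -/
theorem sum_filter_pair_sublist_eq_zero (B : Subring D)
    (hB : Subfield.closure (B : Set D) = ⊤) (hD : ¬ IsCentrallyFinite D) {ι : Type*}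
    [DecidableEq ι] (W : Finset (List ι)) (hW : ∀ w ∈ W, w.Nodup) {i j : ι} (hij : i ≠ j)
    (hi : ∀ w ∈ W, i ∈ w) (hj : ∀ w ∈ W, j ∈ w) (c : List ι → D)
    (h : ∀ a : ι → D, (∀ m, a m ∈ B) → ∑ w ∈ W, c w * (w.map a).prod = 0)
    (a : ι → D) (ha : ∀ m, a m ∈ B) :
    ∑ w ∈ W with [i, j].Sublist w, c w * (w.map a).prod = 0 := by
  have h₁ : ∀ w ∈ W, ¬ [i, j].Sublist w → [j, i].Sublist w := fun w hw hn =>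
    (pair_sublist_or_pair_sublist hij (hi w hw) (hj w hw)).resolve_left hn
  have e₁ : ∀ w, ∃ p q r : D, w ∈ W → ¬ [i, j].Sublist w → ∀ x y : D,
      (w.map (Function.update (Function.update a j x) i y)).prod = p * x * q * y * r := by
    intro w
    by_cases hw : w ∈ W ∧ ¬ [i, j].Sublist w
    · obtain ⟨p, q, r, hp⟩ := exists_prod_map_update_update (hW w hw.1) (h₁ w hw.1 hw.2) a
      exact ⟨p, q, r, fun _ _ => hp⟩
    · exact ⟨0, 0, 0, fun h h' => absurd ⟨h, h'⟩ hw⟩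
  have e₂ : ∀ w, ∃ p q r : D, w ∈ W → [i, j].Sublist w → ∀ x y : D,
      (w.map (Function.update (Function.update a i x) j y)).prod = p * x * q * y * r := by
    intro w
    by_cases hw : w ∈ W ∧ [i, j].Sublist w
    · obtain ⟨p, q, r, hp⟩ := exists_prod_map_update_update (hW w hw.1) hw.2 a
      exact ⟨p, q, r, fun _ _ => hp⟩
    · exact ⟨0, 0, 0, fun h h' => absurd ⟨h, h'⟩ hw⟩
  choose p q r hp using e₁
  choose p' q' r' hp' using e₂
  -- Here `x` replaces variable `j` and `y` replaces variable `i`, so the words with `i` before `j`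
  -- are those with `y` before `x`.
  have key := sum_eq_zero_of_sum_add_sum_eq_zero B hB hD
    (W.filter fun w => ¬ [i, j].Sublist w) (W.filter fun w => [i, j].Sublist w)
    (fun w => c w * p w) q r (fun w => c w * p' w) q' r' (fun x hx y hy => by
      have := h (Function.update (Function.update a i y) j x) fun m => by
        rcases eq_or_ne m j with rfl | hm
        · simpa using hx
        rcases eq_or_ne m i with rfl | hm'
        · simpa [hm] using hy
        · simpa [hm, hm'] using ha m
      rw [← this, add_comm, ← Finset.sum_filter_add_sum_filter_not W fun w => [i, j].Sublist w]
      congr 1 <;> refine Finset.sum_congr rfl fun w hw => ?_ <;>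
        obtain ⟨hw, hs⟩ := Finset.mem_filter.1 hw
      · rw [hp' w hw hs]
        simp only [mul_assoc]
      · rw [Function.update_comm hij, hp w hw hs]
        simp only [mul_assoc]) (a j) (a i)
  rw [← key]
  refine Finset.sum_congr rfl fun w hw => ?_
  obtain ⟨hw, hs⟩ := Finset.mem_filter.1 hw
  have := hp' w hw hs (a i) (a j)
  rw [Function.update_eq_self, Function.update_eq_self] at this
  rw [this]
  simp only [mul_assoc]

/-- **Kaplansky's theorem**, in a form that also covers division rings of fractions: a division
ring generated by a subring satisfying a nontrivial multilinear identity is centrally finite. -/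
theorem isCentrallyFinite_of_multilinear_identity (B : Subring D)
    (hB : Subfield.closure (B : Set D) = ⊤) {ι : Type*} (W : Finset (List ι)) (w₀ : List ι)
    (hw₀ : w₀ ∈ W) (hnd : w₀.Nodup) (hW : ∀ w ∈ W, w.Perm w₀) (c : List ι → D) (hc : c w₀ ≠ 0)
    (h : ∀ a : ι → D, (∀ m, a m ∈ B) → ∑ w ∈ W, c w * (w.map a).prod = 0) :
    IsCentrallyFinite D := by
  classical
  by_contra hD
  have key : ∀ Q : Finset (ι × ι), (∀ ij ∈ Q, [ij.1, ij.2].Sublist w₀) → ∀ a : ι → D,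
      (∀ m, a m ∈ B) →
      ∑ w ∈ W with ∀ ij ∈ Q, [ij.1, ij.2].Sublist w, c w * (w.map a).prod = 0 := by
    intro Q
    induction Q using Finset.induction_on with
    | empty => simpa using h
    | insert ij Q _ ih =>
      intro hQ a ha
      have hs := hQ ij (Finset.mem_insert_self _ _)
      have hmem : ∀ m ∈ [ij.1, ij.2], ∀ w ∈ W.filter
          (fun w => ∀ ij ∈ Q, [ij.1, ij.2].Sublist w), m ∈ w := fun m hm w hw =>
        (hW w (Finset.mem_filter.1 hw).1).mem_iff.2 (hs.subset hm)
      have hne : ij.1 ≠ ij.2 := by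
        have := hnd.sublist hs
        simpa using this
      have := sum_filter_pair_sublist_eq_zero B hB hD
        (W.filter fun w => ∀ ij ∈ Q, [ij.1, ij.2].Sublist w)
        (fun w hw => (hW w (Finset.mem_filter.1 hw).1).nodup_iff.2 hnd) hne
        (hmem _ (by simp)) (hmem _ (by simp)) c
        (ih fun ij h => hQ ij (Finset.mem_insert_of_mem h)) a ha
      rw [Finset.filter_filter] at this
      simpa only [Finset.forall_mem_insert, and_comm] using this
  -- Imposing all order relations of `w₀` leaves only `w₀`.
  have h1 := key ((w₀.toFinset ×ˢ w₀.toFinset).filter fun ij => [ij.1, ij.2].Sublist w₀)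
    (fun ij h => (Finset.mem_filter.1 h).2) (fun _ => 1) fun _ => B.one_mem
  have h2 : ∑ w ∈ ({w₀} : Finset (List ι)), c w * (w.map fun _ => (1 : D)).prod = 0 := by
    rw [← h1]
    refine Finset.sum_congr (Eq.symm ?_) fun _ _ => rfl
    ext w
    simp only [Finset.mem_filter, Finset.mem_product, List.mem_toFinset, Finset.mem_singleton]
    constructor
    · rintro ⟨hw, hs⟩
      have hs' : ∀ {i j : ι}, [i, j].Sublist w₀ → [i, j].Sublist w := fun {i j} hij =>
        hs (i, j) ⟨⟨hij.subset (by simp), hij.subset (by simp)⟩, hij⟩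
      have hwnd := (hW w hw).nodup_iff.2 hnd
      refine List.Perm.eq_of_pairwise (le := fun i j => [i, j].Sublist w) ?_
        (List.pairwise_iff_forall_sublist.2 id) (List.pairwise_iff_forall_sublist.2 hs') (hW w hw)
      intro i j _ _ h₁ h₂
      exact absurd h₂ (not_pair_sublist_of_pair_sublist hwnd h₁)
    · rintro rfl
      exact ⟨hw₀, fun ij h => h.2⟩
  simp at h2
  exact hc h2

end MultilinearIdentity

/-! ### From an arbitrary identity to a multilinear one. -/

section Multilinearization

theorem exists_lift_eq_sum {k : Type*} [Field k] (f : FreeAlgebra k ℕ) (hf : f ≠ 0) :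
    ∃ (U : Finset (List ℕ)) (c : List ℕ → k), U.Nonempty ∧ (∀ u ∈ U, c u ≠ 0) ∧
      ∀ {A : Type*} [Ring A] [Algebra k A] (a : ℕ → A),
        FreeAlgebra.lift k a f = ∑ u ∈ U, c u • (u.map a).prod := by
  let g := FreeAlgebra.equivMonoidAlgebraFreeMonoid f
  have hg : g ≠ 0 := by simpa [g] using hf
  refine ⟨g.coeff.support.map FreeMonoid.toList.toEmbedding,
    fun u => g.coeff (FreeMonoid.ofList u), ?_, ?_, ?_⟩
  · rw [Finset.map_nonempty, Finsupp.support_nonempty_iff]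
    simpa using hg
  · intro u hu
    obtain ⟨v, hv, rfl⟩ := Finset.mem_map.1 hu
    simpa using hv
  · intro A _ _ a
    have h : (FreeAlgebra.lift k a) =
        (MonoidAlgebra.lift k A (FreeMonoid ℕ) (FreeMonoid.lift a)).comp
          (FreeAlgebra.equivMonoidAlgebraFreeMonoid (R := k) (X := ℕ)).toAlgHom := by
      ext n
      simp [FreeAlgebra.equivMonoidAlgebraFreeMonoid]
    rw [h]
    simp only [AlgHom.comp_apply]
    rw [MonoidAlgebra.lift_apply, Finset.sum_map]
    exact Finset.sum_congr rfl fun u _ => by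
      simp only [FreeMonoid.lift_apply]
      rfl

/-- The words in `Fin d` of which a given word is the image under `i`. -/
def wordFiber {d : ℕ} (i : Fin d → ℕ) : List ℕ → Finset (List (Fin d))
  | [] => {[]}
  | n :: u => (({j | i j = n} : Finset (Fin d)) ×ˢ wordFiber i u).image fun p => p.1 :: p.2

theorem mem_wordFiber {d : ℕ} (i : Fin d → ℕ) (u : List ℕ) (v : List (Fin d)) :
    v ∈ wordFiber i u ↔ v.map i = u := by
  induction u generalizing v with
  | nil => simp [wordFiber]
  | cons n u ih =>
    cases v <;> simp [wordFiber, ih]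

theorem prod_map_sum_eq_sum_wordFiber {A : Type*} [Ring A] {d : ℕ} (i : Fin d → ℕ)
    (a : Fin d → A) (u : List ℕ) :
    (u.map fun n => ∑ j with i j = n, a j).prod = ∑ v ∈ wordFiber i u, (v.map a).prod := by
  induction u with
  | nil => simp [wordFiber]
  | cons n u ih =>
    rw [List.map_cons, List.prod_cons, ih, wordFiber, Finset.sum_image, Finset.sum_product]
    · simp only [Finset.sum_mul_sum, List.map_cons, List.prod_cons]
    · rintro ⟨x, y⟩ _ ⟨x', y'⟩ _ h
      simpa using h

/-- Inclusion–exclusion extracts from an identity the part in which all variables occur. -/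
theorem sum_filter_forall_mem_eq_zero {k A : Type*} [Field k] [Ring A] [Algebra k A]
    {ι : Type*} [Fintype ι] [DecidableEq ι]
    [DecidablePred fun v : List ι => ∀ j, j ∈ v] (V : Finset (List ι)) (c : List ι → k)
    (h : ∀ a : ι → A, ∑ v ∈ V, c v • (v.map a).prod = 0) (a : ι → A) :
    ∑ v ∈ V with ∀ j, j ∈ v, c v • (v.map a).prod = 0 := by
  -- Setting the variables in `T` to zero keeps exactly the words avoiding `T`. The signed sum over
  -- subsets of the unused variables vanishes unless every variable is used.
  have hword : ∀ (T : Finset ι) (v : List ι),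
      (v.map fun j => if j ∈ T then 0 else a j).prod =
        if T ∈ (v.toFinsetᶜ).powerset then (v.map a).prod else 0 := by
    intro T v
    split_ifs with hT
    · congr 1
      refine List.map_congr_left fun j hj => if_neg fun hjT => ?_
      have := Finset.mem_powerset.1 hT hjT
      simp [hj] at this
    · obtain ⟨j, hjT, hj⟩ := Finset.not_subset.1 (mt Finset.mem_powerset.2 hT)
      have hjv : j ∈ v := by simpa using hj
      obtain ⟨s, t, rfl⟩ := List.append_of_mem hjv
      simp [hjT]
  have hsum : ∀ v : List ι, ∑ T : Finset ι, (-1 : ℤ) ^ T.card •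
      (v.map fun j => if j ∈ T then 0 else a j).prod =
        if ∀ j, j ∈ v then (v.map a).prod else 0 := by
    intro v
    simp only [hword, smul_ite, smul_zero]
    rw [← Finset.sum_filter, Finset.filter_univ_mem, ← Finset.sum_smul,
      Finset.sum_powerset_neg_one_pow_card]
    simp [Finset.compl_eq_empty_iff, Finset.eq_univ_iff_forall]
  calc ∑ v ∈ V with ∀ j, j ∈ v, c v • (v.map a).prod
      = ∑ v ∈ V, c v • ∑ T : Finset ι, (-1 : ℤ) ^ T.card •
          (v.map fun j => if j ∈ T then 0 else a j).prod := by
        simp only [hsum, smul_ite, smul_zero, Finset.sum_filter]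
    _ = ∑ T : Finset ι, (-1 : ℤ) ^ T.card • ∑ v ∈ V, c v •
          (v.map fun j => if j ∈ T then 0 else a j).prod := by
        simp only [Finset.smul_sum]
        rw [Finset.sum_comm]
        simp only [smul_comm (c _)]
    _ = 0 := Finset.sum_eq_zero fun T _ => by rw [h, smul_zero]

/-- A PI algebra satisfies a nontrivial multilinear identity. -/
theorem IsPIAlgebra.exists_multilinear_identity {k A : Type*} [Field k] [Ring A] [Algebra k A]
    (h : IsPIAlgebra k A) :
    ∃ (d : ℕ) (W : Finset (List (Fin d))) (c : List (Fin d) → k), List.finRange d ∈ W ∧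
      (∀ w ∈ W, w.Perm (List.finRange d)) ∧ c (List.finRange d) ≠ 0 ∧
      ∀ a : Fin d → A, ∑ w ∈ W, c w • (w.map a).prod = 0 := by
  obtain ⟨f, hf, hfA⟩ := h
  obtain ⟨U, c, hU, hc, hfc⟩ := exists_lift_eq_sum f hf
  obtain ⟨u₀, hu₀, hmax⟩ := U.exists_max_image List.length hU
  -- One new variable per position of a longest word `u₀`: each letter is replaced by the sum of the
  -- variables at its positions, and letters absent from `u₀` by the empty sum 0.
  let i : Fin u₀.length → ℕ := u₀.get
  have hi : (List.finRange u₀.length).map i = u₀ := List.map_get_finRange u₀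
  have hmem : ∀ v, v ∈ U.biUnion (wordFiber i) ↔ v.map i ∈ U := by
    simp [mem_wordFiber]
  have hid : ∀ a : Fin u₀.length → A,
      ∑ v ∈ U.biUnion (wordFiber i), c (v.map i) • (v.map a).prod = 0 := by
    intro a
    rw [← hfA fun n => ∑ j with i j = n, a j, hfc, Finset.sum_biUnion]
    · refine Finset.sum_congr rfl fun u _ => ?_
      rw [prod_map_sum_eq_sum_wordFiber, Finset.smul_sum]
      exact Finset.sum_congr rfl fun v hv => by rw [(mem_wordFiber i u v).1 hv]
    · intro u _ u' _ huu'
      refine Finset.disjoint_left.2 fun v hv hv' => huu' ?_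
      rw [← (mem_wordFiber i u v).1 hv, (mem_wordFiber i u' v).1 hv']
  refine ⟨u₀.length, (U.biUnion (wordFiber i)).filter fun v => ∀ j, j ∈ v,
    fun v => c (v.map i), ?_, ?_, ?_,
    fun a => sum_filter_forall_mem_eq_zero _ (fun v => c (v.map i)) hid a⟩
  · rw [Finset.mem_filter, hmem, hi]
    exact ⟨hu₀, List.mem_finRange⟩
  · intro w hw
    obtain ⟨hw, hall⟩ := Finset.mem_filter.1 hw
    -- Maximality of `u₀` bounds the length of `w`, so containing every variable forces each to
    -- occur once.
    have hlen := hmax _ ((hmem w).1 hw)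
    rw [List.length_map] at hlen
    refine ((List.nodup_finRange _).subperm fun j _ => hall j).perm_of_length_le ?_ |>.symm
    simpa using hlen
  · simp only [hi]
    exact hc u₀ hu₀

/-- A division ring generated by the image of a PI algebra is centrally finite. -/
theorem IsPIAlgebra.isCentrallyFinite {k A D : Type*} [Field k] [Ring A] [Algebra k A]
    [DivisionRing D] (h : IsPIAlgebra k A) (ρ : A →+* D)
    (hρ : Subfield.closure (ρ.range : Set D) = ⊤) : IsCentrallyFinite D := by
  obtain ⟨d, W, c, hW₀, hW, hc, h⟩ := h.exists_multilinear_identity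
  refine isCentrallyFinite_of_multilinear_identity ρ.range hρ W (List.finRange d) hW₀
    (List.nodup_finRange d) hW (fun w => ρ (algebraMap k A (c w))) ?_ ?_
  · exact fun h0 => hc ((map_eq_zero (ρ.comp (algebraMap k A))).1 h0)
  · intro a ha
    choose b hb using ha
    obtain rfl : a = ρ ∘ b := funext fun m => (hb m).symm
    have := congrArg ρ (h b)
    rw [map_zero, map_sum] at this
    rw [← this]
    refine Finset.sum_congr rfl fun w _ => ?_
    rw [Algebra.smul_def, map_mul, map_list_prod, List.map_map]

end Multilinearization

/-! ### The standard identity in finite dimension. -/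

section StandardIdentity

/-- The standard polynomial `∑ sign σ • x_{σ 0} ⋯ x_{σ (n-1)}`. -/
noncomputable def standardPolynomial (k : Type*) [Field k] (n : ℕ) : FreeAlgebra k ℕ :=
  ∑ σ : Equiv.Perm (Fin n), Equiv.Perm.sign σ •
    (List.ofFn fun i => FreeAlgebra.ι k (σ i : ℕ)).prod

theorem standardPolynomial_ne_zero (k : Type*) [Field k] (n : ℕ) :
    standardPolynomial k n ≠ 0 := by
  intro h
  let word : Equiv.Perm (Fin n) → FreeMonoid ℕ := fun σ =>
    FreeMonoid.ofList (List.ofFn fun i => (σ i : ℕ))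
  have hinj : ∀ σ, word σ = word 1 → σ = 1 := by
    intro σ hσ
    have := List.ofFn_injective (FreeMonoid.ofList.injective hσ)
    ext i
    exact congrFun this i
  have himg : FreeAlgebra.equivMonoidAlgebraFreeMonoid (standardPolynomial k n) =
      ∑ σ : Equiv.Perm (Fin n), Equiv.Perm.sign σ •
        (MonoidAlgebra.of k (FreeMonoid ℕ) (word σ)) := by
    rw [standardPolynomial, map_sum]
    refine Finset.sum_congr rfl fun σ _ => ?_
    have hw : word σ = (List.ofFn fun i => FreeMonoid.of (σ i : ℕ)).prod := by
      apply FreeMonoid.toList.injective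
      rw [FreeMonoid.toList_prod, List.map_ofFn,
        show (FreeMonoid.toList ∘ fun i => FreeMonoid.of (σ i : ℕ)) =
          (fun m => [m]) ∘ fun i => (σ i : ℕ) from rfl,
        ← List.map_ofFn, ← List.flatMap_def, List.flatMap_singleton']
      rfl
    rw [hw, Units.smul_def, Units.smul_def, map_zsmul, map_list_prod, map_list_prod,
      List.map_ofFn, List.map_ofFn]
    congr 3
    funext i
    simp [FreeAlgebra.equivMonoidAlgebraFreeMonoid]
  rw [h, map_zero] at himg
  have := congrArg (fun g => g.coeff (word 1)) himg
  simp [Units.smul_def] at this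
  rw [Finset.sum_eq_single 1 (fun σ _ hσ => Finsupp.single_eq_of_ne fun h => hσ (hinj σ h.symm))
    (by simp)] at this
  simp at this

/-- An algebra that embeds as a ring into a finite-dimensional subspace of a division algebra
over another field is a PI algebra. -/
theorem isPIAlgebra_of_mem_finiteDimensional {k A E R : Type*} [Field k] [Ring A] [Algebra k A]
    [Field E] [DivisionRing R] [Algebra E R] (ρ : A →+* R) (hρ : Function.Injective ρ)
    (V : Submodule E R) [FiniteDimensional E V] (hV : ∀ x, ρ x ∈ V) : IsPIAlgebra k A := by
  let n := Module.finrank E V + 1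
  refine ⟨standardPolynomial k n, standardPolynomial_ne_zero k n, fun a => hρ ?_⟩
  -- The fields `k` and `E` are unrelated, but the standard polynomial has coefficients ±1, so over
  -- `E` its values are those of an alternating map, zero on `n > dim V` vectors of `V`.
  let alt := MultilinearMap.alternatization (MultilinearMap.mkPiAlgebraFin E n R)
  let v : Fin n → V := fun i => ⟨ρ (a i), hV _⟩
  have hdep : ¬ LinearIndependent E fun i : Fin n => ρ (a i) := by
    intro hli
    have : LinearIndependent E v := LinearIndependent.of_comp V.subtype hli
    have := this.fintype_card_le_finrank
    simp [n] at this
  have h0 := AlternatingMap.map_linearDependent alt _ hdep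
  rw [map_zero, ← h0, MultilinearMap.alternatization_apply, standardPolynomial, map_sum, map_sum]
  refine Finset.sum_congr rfl fun σ _ => ?_
  simp only [Units.smul_def, map_zsmul, map_list_prod, List.map_ofFn,
    MultilinearMap.domDomCongr_apply, MultilinearMap.mkPiAlgebraFin_apply]
  congr 3
  funext i
  simp

end StandardIdentity

/-! ### The two implications. -/

section Main

theorem isLocallyPIAlgebra_of_isWeaklyLocallyFinite {D : Type*} [DivisionRing D]
    (h : IsWeaklyLocallyFinite D) : IsLocallyPIAlgebra (Subring.center D) D := by
  rintro B ⟨S, rfl⟩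
  let L := Subfield.closure (S : Set D)
  have hL : FiniteDimensional (Subring.center L) L := h S
  let Z : Set D := Subtype.val '' (Subring.center L : Set L)
  have hinv : ∀ x ∈ Subring.centralizer Z, x⁻¹ ∈ Subring.centralizer Z := by
    intro x hx
    refine Subring.mem_centralizer_iff.2 fun z hz => ?_
    have : Commute z x := Subring.mem_centralizer_iff.1 hx z hz
    exact this.inv_right₀.eq
  let R : Subfield D := { Subring.centralizer Z with inv_mem' := hinv }
  have hmemR : ∀ {x}, x ∈ R ↔ ∀ z ∈ Z, z * x = x * z := Subring.mem_centralizer_iff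
  have hLR : ∀ x : L, (x : D) ∈ R := by
    intro x
    refine hmemR.2 ?_
    rintro _ ⟨z, hz, rfl⟩
    exact congrArg Subtype.val (Subring.mem_center_iff.1 hz x).symm
  have hFR : ∀ x ∈ Subring.center D, x ∈ R := fun x hx =>
    hmemR.2 fun z _ => Subring.mem_center_iff.1 hx z
  let ψ : L →+* R := (Subfield.subtype L).codRestrict R hLR
  have hψ : ∀ z ∈ Subring.center L, ψ z ∈ Subring.center R := by
    intro z hz
    refine Subring.mem_center_iff.2 fun x => Subtype.ext ?_
    exact (hmemR.1 x.2 z ⟨z, hz, rfl⟩).symm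
  obtain ⟨T, hT⟩ := hL.fg_top
  let V : Submodule (Subring.center R) R := Submodule.span _ (ψ '' (T : Set L))
  have hLV : ∀ x : L, ψ x ∈ V := by
    intro x
    have hx : x ∈ Submodule.span (Subring.center L) (T : Set L) := hT ▸ Submodule.mem_top
    induction hx using Submodule.span_induction with
    | mem x hx => exact Submodule.subset_span ⟨x, hx, rfl⟩
    | zero => simp
    | add x y _ _ hx hy => rw [map_add]; exact V.add_mem hx hy
    | smul z x _ hx =>
      have : ψ (z • x) = (⟨ψ z, hψ z z.2⟩ : Subring.center R) • ψ x := map_mul ψ (z : L) x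
      rw [this]
      exact V.smul_mem _ hx
  -- `V` is also the span of all of `ψ(L)`, hence closed under multiplication.
  have hVL : V ≤ Submodule.span (Subring.center R) (Set.range ψ) := by
    exact Submodule.span_mono (Set.image_subset_range _ _)
  have hVmul : ∀ x ∈ V, ∀ y ∈ V, x * y ∈ V := by
    intro x hx y hy
    have hV' : V = Submodule.span (Subring.center R) (Set.range ψ) :=
      le_antisymm hVL (Submodule.span_le.2 (by rintro _ ⟨x, rfl⟩; exact hLV x))
    have := Submodule.mul_mem_mul (hV' ▸ hx) (hV' ▸ hy)
    rw [Submodule.span_mul_span] at this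
    refine Submodule.span_le.2 ?_ this
    rintro _ ⟨_, ⟨x, rfl⟩, _, ⟨y, rfl⟩, rfl⟩
    simpa using hLV (x * y)
  have hFV : ∀ x (hx : x ∈ Subring.center D), (⟨x, hFR x hx⟩ : R) ∈ V := by
    intro x hx
    have hc : (⟨x, hFR x hx⟩ : R) ∈ Subring.center R :=
      Subring.mem_center_iff.2 fun y => Subtype.ext (Subring.mem_center_iff.1 hx y)
    have : (⟨x, hFR x hx⟩ : R) = (⟨_, hc⟩ : Subring.center R) • ψ 1 := by
      rw [map_one, Subring.smul_def, smul_eq_mul, mul_one]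
    rw [this]
    exact V.smul_mem _ (hLV 1)
  have hB : ∀ x ∈ Algebra.adjoin (Subring.center D) (S : Set D),
      ∃ hx : x ∈ R, (⟨x, hx⟩ : R) ∈ V := by
    intro x hx
    induction hx using Algebra.adjoin_induction with
    | mem x hx =>
      exact ⟨hLR ⟨x, Subfield.subset_closure hx⟩, hLV ⟨x, Subfield.subset_closure hx⟩⟩
    | algebraMap z => exact ⟨hFR z z.2, hFV z z.2⟩
    | add x y _ _ hx hy =>
      obtain ⟨hx, hx'⟩ := hx
      obtain ⟨hy, hy'⟩ := hy
      exact ⟨R.add_mem hx hy, V.add_mem hx' hy'⟩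
    | mul x y _ _ hx hy =>
      obtain ⟨hx, hx'⟩ := hx
      obtain ⟨hy, hy'⟩ := hy
      exact ⟨R.mul_mem hx hy, hVmul _ hx' _ hy'⟩
  have : FiniteDimensional (Subring.center R) V := 
    FiniteDimensional.span_of_finite _ (T.finite_toSet.image ψ)
  let ρ : Algebra.adjoin (Subring.center D) (S : Set D) →+* R :=
    (Subalgebra.val _).toRingHom.codRestrict R fun x => (hB x x.2).1
  refine isPIAlgebra_of_mem_finiteDimensional ρ ?_ V fun x => (hB x x.2).2
  intro x y hxy
  exact Subtype.ext (congrArg (Subtype.val : R → D) hxy)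

theorem isWeaklyLocallyFinite_of_isLocallyPIAlgebra {D : Type*} [DivisionRing D]
    (h : IsLocallyPIAlgebra (Subring.center D) D) : IsWeaklyLocallyFinite D := by
  intro S
  let B := Algebra.adjoin (Subring.center D) (S : Set D)
  let K := Subfield.closure (B : Set D)
  have hBK : ∀ x : B, (x : D) ∈ K := fun x => Subfield.subset_closure x.2
  let ρ : B →+* K := B.val.toRingHom.codRestrict K hBK
  have hρ : Subfield.closure (ρ.range : Set K) = ⊤ := by
    have : (K.subtype : K → D) '' (ρ.range : Set K) = B := by
      ext x
      constructor
      · rintro ⟨_, ⟨y, rfl⟩, rfl⟩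
        exact y.2
      · intro hx
        exact ⟨_, ⟨⟨x, hx⟩, rfl⟩, rfl⟩
    have hmap : (Subfield.closure (ρ.range : Set K)).map K.subtype = K := by
      rw [RingHom.map_field_closure, this]
    rw [eq_top_iff]
    intro x _
    obtain ⟨y, hy, hyx⟩ : (x : D) ∈ (Subfield.closure (ρ.range : Set K)).map K.subtype :=
      hmap.symm ▸ x.2
    exact Subtype.ext hyx ▸ hy
  have hK : IsCentrallyFinite K := (h B ⟨S, rfl⟩).isCentrallyFinite ρ hρ
  have : FiniteDimensional (Subring.center K) K := hK
  have hLK : Subfield.closure (S : Set D) ≤ K :=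
    Subfield.closure_mono Algebra.subset_adjoin
  -- `K` may be larger than the division ring generated by `S`, and central finiteness is not
  -- inherited directly. A standard identity is inherited, so Kaplansky's theorem is applied a
  -- second time.
  have hPI : IsPIAlgebra (Subring.center (Subfield.closure (S : Set D)))
      (Subfield.closure (S : Set D)) :=
    isPIAlgebra_of_mem_finiteDimensional (E := Subring.center K) (Subfield.inclusion hLK)
      (Subfield.inclusion hLK).injective ⊤ fun _ => Submodule.mem_top
  refine hPI.isCentrallyFinite (RingHom.id _) ?_
  rw [eq_top_iff]
  intro x _
  exact Subfield.subset_closure ⟨x, rfl⟩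

end Main

/-- A division ring is weakly locally finite if and only if it is locally PI as an algebra over
its center. -/
theorem theorem2p2 (D : Type*) [DivisionRing D] :
    IsWeaklyLocallyFinite D ↔ IsLocallyPIAlgebra (Subring.center D) D :=
  ⟨isLocallyPIAlgebra_of_isWeaklyLocallyFinite, isWeaklyLocallyFinite_of_isLocallyPIAlgebra⟩
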